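/- A quandle is a set $X$ with a binary operation $*$ such that $a*a=a$ for all $a$, each map $x\mapsto x*b$ is a bijection of $X$, and $(a*b)*c=(a*c)*(b*c)$ for all $a,b,c$. A quandle, or a subquandle, is called trivial if $a*b=a$ for all its elements $a,b$. For $m\in\mathbb{N}$, a quandle $X$ is $m$-almost quasigroup if for every $a\in X$ the stabilizer set $S_a=\{x\in X : a*x=a\}$ has exactly $m$ elements and for every $b\in X\setminus S_a$ the equation $a*x=b$ has a unique solution $x\in X$. The rack chain group $C_n^R(X)=\mathbb{Z}X^n$, $n\ge 0$, is the free abelian group on $n$-tuples of elements of $X$, and $\partial_n:C_n^R(X)\to C_{n-1}^R(X)$ is given by $$\partial_n(x_1,\dots,x_n)=\sum_{i=1}^n(-1)^i\big[(x_1,\dots,x_{i-1},x_{i+1},\dots,x_n)-(x_1*x_i,\dots,x_{i-1}*x_i,x_{i+1},\dots,x_n)\big].$$ Let $C_n^D(X)$ be the subgroup generated by the tuples with $x_i=x_{i+1}$ for some $i$, and let $C_n^Q(X)=C_n^R(X)/C_n^D(X)$. The reduced quandle homology $\widetilde H_n^Q(X)$ is the homology of the augmented quandle chain complex $$\cdots\to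 C_3^Q(X)\xrightarrow{\partial_3}C_2^Q(X)\xrightarrow{\partial_2}C_1^Q(X)\xrightarrow{\varepsilon}C_0^Q(X)=\mathbb{Z}\to 0,\qquad \varepsilon(x)=1 \text{ for all } x\in X,$$ in which $\partial_1=0$ is replaced by the augmentation $\varepsilon$. Corollary 3.3. Let $X$ be a finite $m$-almost quasigroup quandle such that for every $a\in X$ the stabilizer set $S_a$ is a trivial subquandle of $X$. If $X$ is not a trivial quandle, then its reduced quandle homology is annihilated by $N=m\cdot\operatorname{lcm}(|X|,|X|-m)$, i.e. $N\,\widetilde H_n^Q(X)=0$ for all $n\ge 0$. -/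

import Mathlib

namespace QuandleHomology

universe u

section Basic

variable {X : Type u}

/-- The quandle operation `x * y` in right-action notation. Mathlib's `Quandle` is written with
left actions, and `x * y` is `Shelf.act y x`: thus `x * x = x`, right multiplication by `y` is
bijective, and `(x * y) * z = (x * z) * (y * z)`. -/
abbrev op [Shelf X] (x y : X) : X := Shelf.act y x

/-- The inverse operation: `(x * y) /* y = x = (x /* y) * y`. -/
abbrev invOp [Rack X] (x y : X) : X := Rack.invAct y x

/-- A trivial quandle is one with `a * b = a` for all `a`, `b`. -/
def IsTrivialQuandle (X : Type u) [Quandle X] : Prop := ∀ a b : X, op a b = a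

/-- A subquandle is a subset that is closed under the operation and the inverse operation. -/
def IsSubquandle [Quandle X] (S : Set X) : Prop :=
  ∀ a ∈ S, ∀ b ∈ S, op a b ∈ S ∧ invOp a b ∈ S

/-- A subquandle that is, as a quandle, trivial. -/
def IsTrivialSubquandle [Quandle X] (S : Set X) : Prop :=
  IsSubquandle S ∧ ∀ a ∈ S, ∀ b ∈ S, op a b = a

/-- The stabilizer set `S_a = {x | a * x = a}`. -/
def stabilizerSet [Quandle X] (a : X) : Set X := {x | op a x = a}

/-- `m`-almost quasigroup quandles: every stabilizer set `S_a` has exactly `m` elements, and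
for `b ∉ S_a` the equation `a * x = b` has a unique solution. -/
structure IsAlmostQuasigroup (X : Type u) [Quandle X] (m : ℕ) : Prop where
  encard_stabilizerSet : ∀ a : X, (stabilizerSet a).encard = m
  existsUnique_solution : ∀ a b : X, b ∉ stabilizerSet a → ∃! x : X, op a x = b

end Basic

section Chains

variable (X : Type u)

/-- The group of rack chains: the free abelian group on the `n`-tuples of elements of `X`. -/
abbrev RackChain (n : ℕ) : Type u := (Fin n → X) →₀ ℤ

variable {X}

/-- The face map that deletes the entry with index `i`. -/
def face₀ {n : ℕ} (i : Fin (n + 1)) (x : Fin (n + 1) → X) : Fin n → X :=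
  fun j => x (i.succAbove j)

/-- The face map that deletes the entry `x i` and lets it act on all entries before it:
`(x₁ * xᵢ, …, xᵢ₋₁ * xᵢ, xᵢ₊₁, …)`. -/
def face [Shelf X] {n : ℕ} (i : Fin (n + 1)) (x : Fin (n + 1) → X) : Fin n → X :=
  fun j => if j.castSucc < i then op (x j.castSucc) (x i) else x j.succ

variable (X)

/-- The linear extension of `x ↦ face₀ i x - face i x`. -/
noncomputable def faceDiff [Shelf X] {n : ℕ} (i : Fin (n + 1)) :
    RackChain X (n + 1) →ₗ[ℤ] RackChain X n :=
  Finsupp.lmapDomain ℤ ℤ (face₀ i) - Finsupp.lmapDomain ℤ ℤ (face i)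

/-- The boundary `∂ₙ₊₁` of the rack complex. The sign is `(-1)^i` for the entry with number `i`
counted from `1`, that is `(-1)^(i + 1)` for the index `i : Fin (n + 1)`. -/
noncomputable def rackBoundary [Shelf X] (n : ℕ) : RackChain X (n + 1) →ₗ[ℤ] RackChain X n :=
  ∑ i : Fin (n + 1), (-1 : ℤ) ^ (i.val + 1) • faceDiff X i

/-- The augmentation `C₁ → C₀ = ℤ`, with `(x) ↦ 1`; here `C₀` is free on the empty tuple. -/
noncomputable def augmentation : RackChain X 1 →ₗ[ℤ] RackChain X 0 :=
  Finsupp.lmapDomain ℤ ℤ (fun _ => Fin.elim0)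

/-- The boundary of the augmented (reduced) rack complex: in degree `1` the rack boundary, which
is zero, is replaced by the augmentation; all other degrees are unchanged. -/
noncomputable def reducedBoundary [Shelf X] :
    (n : ℕ) → RackChain X (n + 1) →ₗ[ℤ] RackChain X n
  | 0 => augmentation X
  | n + 1 => rackBoundary X (n + 1)

/-- The degenerate chains: the subgroup generated by the tuples with two equal
consecutive entries. -/
noncomputable def degenerate (n : ℕ) : Submodule ℤ (RackChain X n) :=
  Submodule.span ℤ {c | ∃ x : Fin n → X,
    (∃ i j : Fin n, j.val = i.val + 1 ∧ x i = x j) ∧ c = Finsupp.single x 1}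

/-- The group of quandle chains. -/
noncomputable abbrev QuandleChain (n : ℕ) : Type u := RackChain X n ⧸ degenerate X n

variable {X}

theorem faceDiff_single [Shelf X] {n : ℕ} (i : Fin (n + 1)) (x : Fin (n + 1) → X) (c : ℤ) :
    faceDiff X i (Finsupp.single x c) =
      Finsupp.single (face₀ i x) c - Finsupp.single (face i x) c := by
  simp [faceDiff, Finsupp.lmapDomain_apply, Finsupp.mapDomain_single]

theorem face₀_apply {n : ℕ} (i : Fin (n + 1)) (x : Fin (n + 1) → X) (j : Fin n) :
    face₀ i x j = if j.castSucc < i then x j.castSucc else x j.succ := by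
  simp only [face₀, Fin.succAbove]
  split_ifs <;> rfl

theorem faces_comm [Rack X] {n : ℕ} {i j : Fin (n + 1)} (h : i ≤ j) (x : Fin (n + 2) → X) :
    face₀ i (face₀ j.succ x) = face₀ j (face₀ i.castSucc x) ∧
    face₀ i (face j.succ x) = face j (face₀ i.castSucc x) ∧
    face i (face₀ j.succ x) = face₀ j (face i.castSucc x) ∧
    face i (face j.succ x) = face j (face i.castSucc x) := by
  obtain ⟨i, hi⟩ := i
  obtain ⟨j, hj⟩ := j
  have h' : i ≤ j := h
  refine ⟨?_, ?_, ?_, ?_⟩ <;> funext ⟨k, hk⟩ <;>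
    simp only [face₀_apply, face, Fin.lt_def, Fin.castSucc_mk, Fin.succ_mk, op] <;>
    split_ifs <;> first | rfl | omega | exact Shelf.self_distrib.symm

theorem faceDiff_comp [Rack X] {n : ℕ} {i j : Fin (n + 1)} (h : i ≤ j) :
    faceDiff X i ∘ₗ faceDiff X j.succ = faceDiff X j ∘ₗ faceDiff X i.castSucc := by
  refine Finsupp.lhom_ext fun x c => ?_
  obtain ⟨h1, h2, h3, h4⟩ := faces_comm h x
  simp only [LinearMap.comp_apply, faceDiff_single, map_sub, h1, h2, h3, h4]
  abel

theorem rackBoundary_comp [Rack X] (n : ℕ) :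
    rackBoundary X n ∘ₗ rackBoundary X (n + 1) = 0 := by
  refine LinearMap.ext fun c => ?_
  simp only [rackBoundary, LinearMap.comp_apply, LinearMap.sum_apply, LinearMap.smul_apply,
    map_sum, map_smul, Finset.smul_sum, smul_smul, LinearMap.zero_apply]
  rw [Finset.sum_comm, ← Finset.sum_product']
  let P := Fin (n + 1) × Fin (n + 2)
  let S : Finset P := {ij : P | ij.1.val < ij.2.val}
  rw [Finset.univ_product_univ, ← Finset.sum_add_sum_compl S, ← eq_neg_iff_add_eq_zero,
    ← Finset.sum_neg_distrib]
  let φ : ∀ ij : P, ij ∈ S → P := fun ij hij =>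
    (ij.2.pred (by
      rintro h
      have : ij.1.val < ij.2.val := by simpa [S] using hij
      simp [h] at this), ij.1.castSucc)
  refine Finset.sum_bij φ ?_ ?_ ?_ ?_
  · rintro ⟨i, j⟩ hij
    simp only [S, Finset.mem_filter, Finset.mem_univ, true_and] at hij
    simp only [S, φ, Finset.mem_compl, Finset.mem_filter, Finset.mem_univ, true_and,
      Fin.val_castSucc, Fin.val_pred]
    omega
  · rintro ⟨i, j⟩ hij ⟨i', j'⟩ hij' h
    simp only [S, Finset.mem_filter, Finset.mem_univ, true_and] at hij hij'
    have h1 : j.val - 1 = j'.val - 1 := congrArg (fun p : P => p.1.val) h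
    have h2 : i.val = i'.val := congrArg (fun p : P => p.2.val) h
    exact Prod.ext (Fin.ext h2) (Fin.ext (by dsimp only; omega))
  · rintro ⟨i, j⟩ hij
    simp only [S, Finset.mem_compl, Finset.mem_filter, Finset.mem_univ, true_and, not_lt] at hij
    refine ⟨(⟨j.val, by omega⟩, i.succ), ?_, ?_⟩
    · simp only [S, Finset.mem_filter, Finset.mem_univ, true_and, Fin.val_succ]
      omega
    · simp [φ]
  · rintro ⟨i, j⟩ hij
    simp only [S, Finset.mem_filter, Finset.mem_univ, true_and] at hij
    obtain ⟨j, rfl⟩ := Fin.exists_succ_eq.mpr (show j ≠ 0 by rintro rfl; simp at hij)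
    have hle : i ≤ j := by
      rw [Fin.le_def]; simp only [Fin.val_succ] at hij; omega
    simp only [φ, Fin.pred_succ, Fin.val_succ, Fin.val_castSucc, ← neg_smul]
    rw [← LinearMap.comp_apply, faceDiff_comp hle, LinearMap.comp_apply]
    congr 1
    ring

theorem reducedBoundary_comp [Rack X] (n : ℕ) :
    reducedBoundary X n ∘ₗ reducedBoundary X (n + 1) = 0 := by
  cases n with
  | succ n => exact rackBoundary_comp (n + 1)
  | zero =>
    refine Finsupp.lhom_ext fun x c => ?_
    have h : ∀ y z : Fin 1 → X, augmentation X (Finsupp.single y c - Finsupp.single z c) = 0 := by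
      intro y z
      rw [map_sub]
      simp [augmentation, Finsupp.lmapDomain_apply, Finsupp.mapDomain_single]
    simp [reducedBoundary, rackBoundary, Fin.sum_univ_two, faceDiff_single, h]

theorem single_mem_degenerate {n : ℕ} {x : Fin n → X} (i j : Fin n) (hij : j.val = i.val + 1)
    (hx : x i = x j) : Finsupp.single x (1 : ℤ) ∈ degenerate X n :=
  Submodule.subset_span ⟨x, ⟨i, j, hij, hx⟩, rfl⟩

theorem degenerate_one : degenerate X 1 = ⊥ := by
  rw [degenerate, Submodule.span_eq_bot]
  rintro _ ⟨x, ⟨i, j, hij, -⟩, -⟩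
  omega

theorem rackBoundary_degenerate [Quandle X] (n : ℕ) :
    degenerate X (n + 1) ≤ (degenerate X n).comap (rackBoundary X n) := by
  rw [degenerate, Submodule.span_le]
  rintro _ ⟨x, ⟨k, l, hkl, hx⟩, rfl⟩
  rw [SetLike.mem_coe, Submodule.mem_comap]
  have hne : k ≠ l := by rintro rfl; omega
  have key : ∀ i, i ≠ k ∧ i ≠ l →
      faceDiff X i (Finsupp.single x 1) ∈ degenerate X n := by
    rintro i ⟨hik, hil⟩
    rw [faceDiff_single]
    rw [Ne, Fin.ext_iff] at hik hil
    rcases lt_or_gt_of_ne hik with h | h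
    · have e1 : (⟨k.val - 1, by omega⟩ : Fin n).succ = k := Fin.ext (by simp; omega)
      have e2 : (⟨k.val, by omega⟩ : Fin n).succ = l := Fin.ext (by simp; omega)
      refine Submodule.sub_mem _ ?_ ?_ <;>
        refine single_mem_degenerate ⟨k.val - 1, by omega⟩ ⟨k.val, by omega⟩
          (by simp; omega) ?_
      · rw [face₀_apply, face₀_apply, if_neg, if_neg, e1, e2, hx] <;>
          simp only [Fin.lt_def, Fin.val_castSucc] <;> omega
      · rw [face, if_neg, face, if_neg, e1, e2, hx] <;>
          simp only [Fin.lt_def, Fin.val_castSucc] <;> omega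
    · have e1 : (⟨k.val, by omega⟩ : Fin n).castSucc = k := Fin.ext (by simp)
      have e2 : (⟨k.val + 1, by omega⟩ : Fin n).castSucc = l := Fin.ext (by simp; omega)
      refine Submodule.sub_mem _ ?_ ?_ <;>
        refine single_mem_degenerate ⟨k.val, by omega⟩ ⟨k.val + 1, by omega⟩ rfl ?_
      · rw [face₀_apply, face₀_apply, if_pos, if_pos, e1, e2, hx] <;>
          simp only [Fin.lt_def, Fin.val_castSucc] <;> omega
      · rw [face, if_pos, face, if_pos, e1, e2, hx] <;>
          simp only [Fin.lt_def, Fin.val_castSucc] <;> omega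
  have hface₀ : face₀ k x = face₀ l x := by
    funext ⟨j, hj⟩
    rw [face₀_apply, face₀_apply]
    simp only [Fin.lt_def, Fin.val_castSucc]
    split_ifs with h1 h2 h2
    · rfl
    · omega
    · have e1 : (⟨j, hj⟩ : Fin n).castSucc = k := Fin.ext (by simp; omega)
      have e2 : (⟨j, hj⟩ : Fin n).succ = l := Fin.ext (by simp; omega)
      rw [e1, e2, hx]
    · rfl
  have hface : face k x = face l x := by
    funext ⟨j, hj⟩
    simp only [face, Fin.lt_def, Fin.val_castSucc]
    split_ifs with h1 h2 h2
    · rw [hx]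
    · omega
    · have e1 : (⟨j, hj⟩ : Fin n).castSucc = k := Fin.ext (by simp; omega)
      have e2 : (⟨j, hj⟩ : Fin n).succ = l := Fin.ext (by simp; omega)
      rw [e1, e2, hx, op, Quandle.fix]
    · rfl
  have hkleq : faceDiff X k (Finsupp.single x 1) = faceDiff X l (Finsupp.single x 1) := by
    rw [faceDiff_single, faceDiff_single, hface₀, hface]
  simp only [rackBoundary, LinearMap.sum_apply, LinearMap.smul_apply]
  rw [← Finset.add_sum_erase _ _ (Finset.mem_univ k),
    ← Finset.add_sum_erase _ _ (Finset.mem_erase.mpr ⟨hne.symm, Finset.mem_univ l⟩), ← add_assoc]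
  refine Submodule.add_mem _ ?_ (Submodule.sum_mem _ fun i hi => ?_)
  · rw [hkleq, hkl, pow_succ _ (k.val + 1), mul_neg_one, neg_smul, add_neg_cancel]
    exact Submodule.zero_mem _
  · simp only [Finset.mem_erase, Finset.mem_univ, and_true] at hi
    exact Submodule.smul_mem _ _ (key i ⟨hi.2, hi.1⟩)

theorem reducedBoundary_degenerate [Quandle X] (n : ℕ) :
    degenerate X (n + 1) ≤ (degenerate X n).comap (reducedBoundary X n) := by
  cases n with
  | zero => rw [degenerate_one]; exact bot_le
  | succ n => exact rackBoundary_degenerate (n + 1)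

end Chains

section Complex

variable (X : Type u) [Quandle X]

/-- The boundary induced by `reducedBoundary` on quandle chains. -/
noncomputable def reducedQuandleBoundary (n : ℕ) :
    QuandleChain X (n + 1) →ₗ[ℤ] QuandleChain X n :=
  Submodule.mapQ _ _ (reducedBoundary X n) (reducedBoundary_degenerate n)

theorem reducedQuandleBoundary_comp (n : ℕ) :
    reducedQuandleBoundary X n ∘ₗ reducedQuandleBoundary X (n + 1) = 0 := by
  refine Submodule.linearMap_qext _ (LinearMap.ext fun c => ?_)
  have h := LinearMap.congr_fun (reducedBoundary_comp (X := X) n) c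
  simp only [LinearMap.comp_apply, LinearMap.zero_apply] at h
  simp [reducedQuandleBoundary, h]

/-- The augmented quandle chain complex
`⋯ → C₂ → C₁ → C₀ = ℤ` (quandle chains, with the augmentation as the last map), whose homology is
the reduced quandle homology of `X`. -/
noncomputable def reducedQuandleComplex : ChainComplex (ModuleCat.{u} ℤ) ℕ :=
  ChainComplex.of (fun n => ModuleCat.of ℤ (QuandleChain X n))
    (fun n => ModuleCat.ofHom (reducedQuandleBoundary X n))
    (fun n => by
      rw [← ModuleCat.ofHom_comp, reducedQuandleBoundary_comp]
      rfl)

theorem reducedQuandleComplex_d (n : ℕ) :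
    (reducedQuandleComplex X).d (n + 1) n = ModuleCat.ofHom (reducedQuandleBoundary X n) :=
  ChainComplex.of_d (X := fun n => ModuleCat.of ℤ (QuandleChain X n))
    (d := fun n => ModuleCat.ofHom (reducedQuandleBoundary X n)) n

/-- The reduced quandle homology groups (with integer coefficients). -/
noncomputable abbrev ReducedQuandleHomology (n : ℕ) : ModuleCat.{u} ℤ :=
  (reducedQuandleComplex X).homology n

end Complex

end QuandleHomology

/-! Write k for |X|. Multiplication by k(k - m) is null-homotopic on the augmented quandle complex,
and k(k - m) divides m·lcm(k, k - m). The homotopy inserts a summed entry y behind the head a of (a,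
t). Since y ↦ a * y permutes the complement of S_a and is constantly a on S_a, `sum_op_left` shows
that the terms deleting y give (k - m)(a, t), minus the sum of all (z, t), plus the sum over z in
S_a. That last sum is removed by scaling by k and subtracting the same expression for every head in
S_a; this needs S_z = S_a for z in S_a, which triviality of the stabilizers provides
(`sum_stabilizer_relation`). All other faces cancel because right multiplications are automorphisms
(`rackBoundary_insertSecond`). The remaining sum over all (z, t) does not depend on a. In degree 1
the augmentation term absorbs it; in higher degrees it disappears on subtracting the same formula
for the degenerate tuple (t₀, t), which is what `repeatSecond` does. -/

namespace QuandleHomology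

open Finset

universe v

/-! ### Stabilizer classes and sums over the quandle -/

section Stabilizers

variable {X : Type v} [Quandle X]

theorem op_op_op (a b c : X) : op (op a b) c = op (op a c) (op b c) :=
  Shelf.self_distrib

theorem op_right_injective (c : X) : Function.Injective fun a : X => op a c :=
  (Rack.act' c).injective

theorem op_right_bijective (c : X) : Function.Bijective fun a : X => op a c :=
  (Rack.act' c).bijective

theorem self_mem_stabilizerSet (a : X) : a ∈ stabilizerSet a :=
  Quandle.fix

/-- Right multiplication by c is an automorphism, so it carries S_a onto S_{a * c}. -/
theorem op_mem_stabilizerSet_op {a z : X} (c : X) :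
    op z c ∈ stabilizerSet (op a c) ↔ z ∈ stabilizerSet a := by
  simp only [stabilizerSet, Set.mem_ofPred_eq]
  rw [← op_op_op]
  exact (op_right_injective c).eq_iff

/-- If all stabilizer sets are trivial subquandles, they are the classes of an equivalence
relation. -/
theorem stabilizerSet_eq_of_mem
    (hS : ∀ a : X, IsTrivialSubquandle (stabilizerSet a)) {a z : X}
    (hz : z ∈ stabilizerSet a) : stabilizerSet z = stabilizerSet a := by
  -- Triviality of S_b gives c * d = c for all c, d in S_b. Applied to d = a, this makes membership
  -- symmetric.
  have key : ∀ {b c : X}, c ∈ stabilizerSet b → stabilizerSet b ⊆ stabilizerSet c :=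
    fun {b c} hc d hd => (hS b).2 c hc d hd
  exact (key (key hz (self_mem_stabilizerSet a))).antisymm (key hz)

variable [Fintype X]

/-- The stabilizer set as a finite set. -/
noncomputable def stabilizerFinset (a : X) : Finset X :=
  (stabilizerSet a).toFinite.toFinset

@[simp]
theorem mem_stabilizerFinset {a z : X} : z ∈ stabilizerFinset a ↔ op a z = a := by
  simp [stabilizerFinset, stabilizerSet]

theorem card_stabilizerFinset {m : ℕ} (hX : IsAlmostQuasigroup X m) (a : X) :
    #(stabilizerFinset a) = m := by
  have h := hX.encard_stabilizerSet a
  rw [(stabilizerSet a).toFinite.encard_eq_coe_toFinset_card] at h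
  exact_mod_cast h

theorem stabilizerFinset_eq_of_mem
    (hS : ∀ a : X, IsTrivialSubquandle (stabilizerSet a)) {a z : X}
    (hz : z ∈ stabilizerFinset a) : stabilizerFinset z = stabilizerFinset a := by
  have := stabilizerSet_eq_of_mem hS (a := a) (z := z) (mem_stabilizerFinset.1 hz)
  simp only [stabilizerFinset, this]

theorem sum_stabilizerFinset_op {M : Type*} [AddCommGroup M] (a c : X) (f : X → M) :
    ∑ z ∈ stabilizerFinset a, f (op z c) = ∑ z ∈ stabilizerFinset (op a c), f z := by
  refine Finset.sum_bij (fun z _ => op z c) (fun z hz => ?_)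
    (fun z _ w _ h => op_right_injective c h) (fun w hw => ?_) (fun _ _ => rfl)
  · have := (op_mem_stabilizerSet_op (a := a) (z := z) c).2 (mem_stabilizerFinset.1 hz)
    exact mem_stabilizerFinset.2 this
  · obtain ⟨z, rfl⟩ := (op_right_bijective c).2 w
    exact ⟨z, mem_stabilizerFinset.2
      ((op_mem_stabilizerSet_op (a := a) (z := z) c).1 (mem_stabilizerFinset.1 hw)), rfl⟩

theorem sum_op_right {M : Type*} [AddCommGroup M] (c : X) (f : X → M) :
    ∑ y, f (op y c) = ∑ y, f y :=
  (op_right_bijective c).sum_comp f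

-- The solution map g of a * g b = b is injective on the complement of S_a and stays there: if g b
-- were in S_a, then b = a, which lies in S_a. By finiteness g is a permutation of the complement.
open Classical in
theorem sum_compl_stabilizerFinset_op {M : Type*} [AddCommGroup M] {m : ℕ}
    (hX : IsAlmostQuasigroup X m) (a : X) (f : X → M) :
    ∑ y ∈ (stabilizerFinset a)ᶜ, f (op a y) = ∑ z ∈ (stabilizerFinset a)ᶜ, f z := by
  choose! g hg _ using fun b hb => hX.existsUnique_solution a b hb
  have hmem : ∀ b, b ∈ (stabilizerFinset a)ᶜ ↔ b ∉ stabilizerSet a := fun b => by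
    rw [mem_compl, mem_stabilizerFinset]; rfl
  have hinj : Set.InjOn g ((stabilizerFinset a)ᶜ : Finset X) := by
    intro b hb c hc h
    rw [mem_coe, hmem] at hb hc
    rw [← hg b hb, ← hg c hc, h]
  have himage : image g (stabilizerFinset a)ᶜ = (stabilizerFinset a)ᶜ := by
    refine eq_of_subset_of_card_le (fun x hx => ?_) (card_image_of_injOn hinj).ge
    obtain ⟨b, hb, rfl⟩ := mem_image.1 hx
    rw [hmem] at hb ⊢
    intro h
    apply hb
    rw [← hg b hb, show op a (g b) = a from h]
    exact self_mem_stabilizerSet a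
  conv_lhs => rw [← himage]
  rw [sum_image hinj]
  exact sum_congr rfl fun b hb => by rw [hg b ((hmem b).1 hb)]

theorem sum_op_left {M : Type*} [AddCommGroup M] {m : ℕ}
    (hX : IsAlmostQuasigroup X m) (a : X) (f : X → M) :
    ∑ y, f (op a y) = (m : ℤ) • f a + ∑ z, f z - ∑ z ∈ stabilizerFinset a, f z := by
  classical
  have h : ∑ y ∈ stabilizerFinset a, f (op a y) = (m : ℤ) • f a := by
    rw [sum_congr rfl fun y hy => by rw [mem_stabilizerFinset.1 hy], sum_const,
      card_stabilizerFinset hX, natCast_zsmul]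
  rw [← sum_add_sum_compl (stabilizerFinset a) fun y => f (op a y), h,
    sum_compl_stabilizerFinset_op hX, ← sum_add_sum_compl (stabilizerFinset a) f]
  abel

/-- Subtracting the sum over S_a cancels the stabilizer sums from `sum_op_left`: with S_z = S_a for
z in S_a, their coefficients k, -(k - m) and -m add up to zero, where k = |X|. -/
theorem sum_stabilizer_relation {M : Type*} [AddCommGroup M] {m : ℕ}
    (hX : IsAlmostQuasigroup X m) (hS : ∀ a : X, IsTrivialSubquandle (stabilizerSet a))
    (a : X) (f : X → M) :
    ∑ y, ((Fintype.card X : ℤ) • (f a - f (op a y)) -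
        ∑ z ∈ stabilizerFinset a, (f z - f (op z y))) =
      ((Fintype.card X : ℤ) - m) • ((Fintype.card X : ℤ) • f a - ∑ z, f z) := by
  have h1 : ∀ z, ∑ y, (f z - f (op z y)) = ((Fintype.card X : ℤ) - m) • f z - ∑ u, f u +
      ∑ u ∈ stabilizerFinset z, f u := fun z => by
    rw [sum_sub_distrib, sum_op_left hX, sum_const, card_univ, ← natCast_zsmul]
    module
  have h2 : ∑ z ∈ stabilizerFinset a, ∑ u ∈ stabilizerFinset z, f u =
      (m : ℤ) • ∑ u ∈ stabilizerFinset a, f u := by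
    rw [sum_congr rfl fun z hz => by rw [stabilizerFinset_eq_of_mem hS hz], sum_const,
      card_stabilizerFinset hX, natCast_zsmul]
  rw [sum_sub_distrib, ← smul_sum, sum_comm, sum_congr rfl fun z _ => h1 z, h1, sum_add_distrib,
    sum_sub_distrib, h2, sum_const, card_stabilizerFinset hX, ← smul_sum, ← natCast_zsmul]
  module

end Stabilizers

/-! ### Boundary formulas and the null-homotopy -/

section Homotopy

variable {X : Type v}

theorem face₀_zero_cons {n : ℕ} (a : X) (t : Fin n → X) :
    face₀ 0 (Fin.cons a t : Fin (n + 1) → X) = t := by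
  funext j
  simp [face₀]

theorem face_zero_cons [Shelf X] {n : ℕ} (a : X) (t : Fin n → X) :
    face 0 (Fin.cons a t : Fin (n + 1) → X) = t := by
  funext j
  simp [face]

theorem face₀_succ_cons {n : ℕ} (i : Fin (n + 1)) (a : X) (t : Fin (n + 1) → X) :
    face₀ i.succ (Fin.cons a t : Fin (n + 2) → X) = Fin.cons a (face₀ i t) := by
  funext j
  refine Fin.cases ?_ (fun j => ?_) j <;> simp [face₀]

theorem face_succ_cons [Shelf X] {n : ℕ} (i : Fin (n + 1)) (a : X) (t : Fin (n + 1) → X) :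
    face i.succ (Fin.cons a t : Fin (n + 2) → X) = Fin.cons (op a (t i)) (face i t) := by
  funext j
  refine Fin.cases ?_ (fun j => ?_) j
  · simp [face]
  · simp only [face, Fin.cons_succ, ← Fin.succ_castSucc, Fin.succ_lt_succ_iff]

/-- The generator of the rack chains given by the tuple with head `a` and tail `t`. -/
noncomputable def consChain {n : ℕ} (a : X) (t : Fin n → X) : RackChain X (n + 1) :=
  Finsupp.single (Fin.cons a t) 1

/-- Deleting the head contributes nothing, as no entry precedes it; the remaining indices shift by
one, which flips the sign. -/
theorem rackBoundary_consChain [Shelf X] {n : ℕ} (a : X) (t : Fin (n + 1) → X) :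
    rackBoundary X (n + 1) (consChain a t) = ∑ i : Fin (n + 1), (-1 : ℤ) ^ i.val •
      (consChain a (face₀ i t) - consChain (op a (t i)) (face i t)) := by
  simp only [rackBoundary, LinearMap.sum_apply, LinearMap.smul_apply, consChain]
  rw [Fin.sum_univ_succ]
  simp only [faceDiff_single, face₀_zero_cons, face_zero_cons, face₀_succ_cons, face_succ_cons,
    sub_self, smul_zero, zero_add, Fin.val_succ]
  exact sum_congr rfl fun i _ => by rw [pow_add, pow_add]; simp

theorem rackBoundary_consChain_cons [Shelf X] {n : ℕ} (a b : X) (t : Fin (n + 1) → X) :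
    rackBoundary X (n + 2) (consChain a (Fin.cons b t)) =
      consChain a t - consChain (op a b) t - ∑ i : Fin (n + 1), (-1 : ℤ) ^ i.val •
      (consChain a (Fin.cons b (face₀ i t)) -
        consChain (op a (t i)) (Fin.cons (op b (t i)) (face i t))) := by
  rw [rackBoundary_consChain, Fin.sum_univ_succ]
  simp only [face₀_zero_cons, face_zero_cons, face₀_succ_cons, face_succ_cons, Fin.cons_zero,
    Fin.cons_succ, Fin.val_zero, pow_zero, one_smul, Fin.val_succ, pow_succ, mul_neg_one, neg_smul,
    sum_neg_distrib, ← sub_eq_add_neg]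

theorem rackBoundary_consChain_cons_zero [Shelf X] (a b : X) (t : Fin 0 → X) :
    rackBoundary X 1 (consChain a (Fin.cons b t)) = consChain a t - consChain (op a b) t := by
  rw [rackBoundary_consChain, Fin.sum_univ_one]
  simp [face₀_zero_cons, face_zero_cons]

theorem rackChain_hom_ext {M : Type*} [AddCommGroup M] {n : ℕ}
    {f g : RackChain X (n + 1) →ₗ[ℤ] M} (h : ∀ a t, f (consChain a t) = g (consChain a t)) :
    f = g := by
  refine Finsupp.lhom_ext' fun x => LinearMap.ext_ring ?_
  have := h (x 0) (Fin.tail x)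
  rwa [consChain, Fin.cons_self_tail] at this

/-- The linear extension of `(a, b, t) ↦ (b, b, t)`. -/
noncomputable def repeatSecond (X : Type v) (n : ℕ) :
    RackChain X (n + 2) →ₗ[ℤ] RackChain X (n + 2) :=
  Finsupp.lmapDomain ℤ ℤ fun x => Fin.cons (x 1) (Fin.tail x)

@[simp]
theorem repeatSecond_consChain {n : ℕ} (a : X) (t : Fin (n + 1) → X) :
    repeatSecond X n (consChain a t) = consChain (t 0) t := by
  simp only [repeatSecond, consChain, Finsupp.lmapDomain_apply, Finsupp.mapDomain_single,
    Fin.cons_one, Fin.tail_cons]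

/-- Deleting the second entry b contributes zero on both sides: on the left because b * b = b, on
the right because the heads a and a * b are forgotten. -/
theorem rackBoundary_repeatSecond [Quandle X] (n : ℕ) :
    rackBoundary X (n + 2) ∘ₗ repeatSecond X (n + 1) =
      repeatSecond X n ∘ₗ rackBoundary X (n + 2) := by
  refine rackChain_hom_ext fun a s => ?_
  obtain ⟨b, t, rfl⟩ : ∃ b t, s = Fin.cons b t := ⟨s 0, Fin.tail s, (Fin.cons_self_tail s).symm⟩
  simp only [LinearMap.comp_apply, repeatSecond_consChain, rackBoundary_consChain_cons,
    Fin.cons_zero, map_sub, map_sum, map_smul, sub_self, op, Quandle.fix]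

theorem rackBoundary_repeatSecond_zero [Quandle X] :
    rackBoundary X 1 ∘ₗ repeatSecond X 0 = 0 := by
  refine rackChain_hom_ext fun a s => ?_
  obtain ⟨b, t, rfl⟩ : ∃ b t, s = Fin.cons b t := ⟨s 0, Fin.tail s, (Fin.cons_self_tail s).symm⟩
  simp only [LinearMap.comp_apply, repeatSecond_consChain, rackBoundary_consChain_cons_zero,
    Fin.cons_zero, sub_self, op, Quandle.fix, LinearMap.zero_apply]

theorem consChain_mem_degenerate_of_head {n : ℕ} (t : Fin (n + 1) → X) :
    consChain (t 0) t ∈ degenerate X (n + 2) :=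
  single_mem_degenerate 0 1 rfl (by rw [Fin.cons_zero, Fin.cons_one])

theorem repeatSecond_mem_degenerate {n : ℕ} (c : RackChain X (n + 2)) :
    repeatSecond X n c ∈ degenerate X (n + 2) := by
  have h : (degenerate X (n + 2)).mkQ ∘ₗ repeatSecond X n = 0 := by
    refine rackChain_hom_ext fun a t => ?_
    simpa using consChain_mem_degenerate_of_head t
  simpa using LinearMap.congr_fun h c

theorem consChain_mem_degenerate_of_tail {n : ℕ} (a : X) {t : Fin n → X} {i j : Fin n}
    (hij : j.val = i.val + 1) (ht : t i = t j) : consChain a t ∈ degenerate X (n + 1) :=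
  single_mem_degenerate i.succ j.succ (by simp [hij]) (by simpa using ht)

theorem augmentation_consChain (a : X) (t : Fin 0 → X) :
    augmentation X (consChain a t) = Finsupp.single t 1 := by
  simp only [augmentation, consChain, Finsupp.lmapDomain_apply, Finsupp.mapDomain_single]
  congr 1
  exact Subsingleton.elim _ _

variable [Quandle X] [Fintype X]

/-- The linear extension of `(a, t) ↦ ∑ y, (|X| (a, y, t) - ∑ z ∈ S_a, (z, y, t))`. -/
noncomputable def insertSecond (X : Type v) [Quandle X] [Fintype X] (n : ℕ) :
    RackChain X (n + 1) →ₗ[ℤ] RackChain X (n + 2) :=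
  Finsupp.linearCombination ℤ fun x => ∑ y,
    ((Fintype.card X : ℤ) • consChain (x 0) (Fin.cons y (Fin.tail x)) -
      ∑ z ∈ stabilizerFinset (x 0), consChain z (Fin.cons y (Fin.tail x)))

theorem insertSecond_consChain {n : ℕ} (a : X) (t : Fin n → X) :
    insertSecond X n (consChain a t) = ∑ y,
      ((Fintype.card X : ℤ) • consChain a (Fin.cons y t) -
        ∑ z ∈ stabilizerFinset a, consChain z (Fin.cons y t)) := by
  simp [insertSecond, consChain]

/-- Reindexing y and z along right multiplication by c puts the insertion into the form in which c
acts on every entry before the tail, as in a face map. -/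
theorem insertSecond_consChain_op {n : ℕ} (a c : X) (t : Fin n → X) :
    insertSecond X n (consChain (op a c) t) = ∑ y,
      ((Fintype.card X : ℤ) • consChain (op a c) (Fin.cons (op y c) t) -
        ∑ z ∈ stabilizerFinset a, consChain (op z c) (Fin.cons (op y c) t)) := by
  rw [insertSecond_consChain, ← sum_op_right c]
  refine sum_congr rfl fun y _ => ?_
  rw [sum_stabilizerFinset_op a c fun z => consChain z (Fin.cons (op y c) t)]

theorem rackBoundary_insertSecond_zero {m : ℕ} (hX : IsAlmostQuasigroup X m)
    (hS : ∀ a : X, IsTrivialSubquandle (stabilizerSet a)) (a : X) (t : Fin 0 → X) :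
    rackBoundary X 1 (insertSecond X 0 (consChain a t)) =
      ((Fintype.card X : ℤ) - m) • ((Fintype.card X : ℤ) • consChain a t -
        ∑ z, consChain z t) := by
  rw [← sum_stabilizer_relation hX hS a fun z => consChain z t, insertSecond_consChain]
  simp only [map_sum, map_sub, map_smul, rackBoundary_consChain_cons_zero]

theorem rackBoundary_insertSecond {m : ℕ} (hX : IsAlmostQuasigroup X m)
    (hS : ∀ a : X, IsTrivialSubquandle (stabilizerSet a)) {n : ℕ} (a : X) (t : Fin (n + 1) → X) :
    rackBoundary X (n + 2) (insertSecond X (n + 1) (consChain a t)) +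
      insertSecond X n (rackBoundary X (n + 1) (consChain a t)) =
      ((Fintype.card X : ℤ) - m) • ((Fintype.card X : ℤ) • consChain a t -
        ∑ z, consChain z t) := by
  rw [← sum_stabilizer_relation hX hS a fun z => consChain z t, insertSecond_consChain,
    rackBoundary_consChain]
  simp only [map_sum, map_sub, map_smul, rackBoundary_consChain_cons, insertSecond_consChain_op]
  simp only [insertSecond_consChain, smul_sub, sum_sub_distrib, smul_sum,
    smul_comm _ (Fintype.card X : ℤ)]
  -- With the sum over faces outermost, the faces of the tail occur in both summands with opposite
  -- signs.
  have hc1 : ∀ F : X → Fin (n + 1) → RackChain X (n + 2),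
      ∑ y, ∑ i, F y i = ∑ i, ∑ y, F y i := fun _ => sum_comm
  have hc2 : ∀ F : X → X → Fin (n + 1) → RackChain X (n + 2),
      ∑ y, ∑ z ∈ stabilizerFinset a, ∑ i, F y z i =
        ∑ i, ∑ y, ∑ z ∈ stabilizerFinset a, F y z i := fun F => by
    rw [sum_comm (s := univ (α := Fin (n + 1)))]
    exact sum_congr rfl fun y _ => sum_comm
  simp only [hc1, hc2]
  abel

/-- A null-homotopy, modulo degenerate chains, of the multiplication by `|X| (|X| - m)`. -/
noncomputable def nullHomotopy (X : Type v) [Quandle X] [Fintype X] (m : ℕ) :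
    (n : ℕ) → RackChain X n →ₗ[ℤ] RackChain X (n + 1)
  | 0 => Finsupp.linearCombination ℤ fun t => ((Fintype.card X : ℤ) - m) • ∑ z, consChain z t
  | 1 => insertSecond X 0
  | n + 2 => insertSecond X (n + 1) ∘ₗ (LinearMap.id - repeatSecond X n)

/-- A repetition in the first two entries is fixed by `repeatSecond` and so is killed; a later one
lies in the tail, which insertion leaves intact. -/
theorem nullHomotopy_degenerate (m n : ℕ) :
    degenerate X n ≤ (degenerate X (n + 1)).comap (nullHomotopy X m n) := by
  rw [degenerate, Submodule.span_le]
  rintro _ ⟨x, ⟨i, j, hij, hx⟩, rfl⟩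
  match n with
  | 0 => exact i.elim0
  | 1 => omega
  | n + 2 =>
    obtain ⟨a, t, rfl⟩ : ∃ a t, x = Fin.cons a t := ⟨x 0, Fin.tail x, (Fin.cons_self_tail x).symm⟩
    rw [SetLike.mem_coe, Submodule.mem_comap]
    change insertSecond X (n + 1) (consChain a t - repeatSecond X n (consChain a t)) ∈ _
    rw [repeatSecond_consChain]
    obtain ⟨j, rfl⟩ := Fin.exists_succ_eq.2 (show j ≠ 0 by rintro rfl; simp at hij)
    induction i using Fin.cases with
    | zero =>
      obtain rfl : j = 0 := Fin.ext (by simpa using hij)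
      obtain rfl : a = t 0 := by simpa using hx
      simp
    | succ i =>
      have hij' : j.val = i.val + 1 := by simpa using hij
      have ht : t i = t j := by simpa using hx
      have key : ∀ b, insertSecond X (n + 1) (consChain b t) ∈ degenerate X (n + 3) := fun b => by
        rw [insertSecond_consChain]
        have hd : ∀ z y, consChain z (Fin.cons y t : Fin (n + 2) → X) ∈ degenerate X (n + 3) :=
          fun z y => consChain_mem_degenerate_of_tail z (i := i.succ) (j := j.succ)
            (by simp [hij']) (by simpa using ht)
        exact Submodule.sum_mem _ fun y _ => Submodule.sub_mem _
          (Submodule.smul_mem _ _ (hd _ _)) (Submodule.sum_mem _ fun z _ => hd _ _)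
      rw [map_sub]
      exact Submodule.sub_mem _ (key _) (key _)

theorem reducedBoundary_nullHomotopy_zero (m : ℕ) (c : RackChain X 0) :
    reducedBoundary X 0 (nullHomotopy X m 0 c) =
      ((Fintype.card X : ℤ) * ((Fintype.card X : ℤ) - m)) • c := by
  suffices h : reducedBoundary X 0 ∘ₗ nullHomotopy X m 0 =
      ((Fintype.card X : ℤ) * ((Fintype.card X : ℤ) - m)) • LinearMap.id from
    LinearMap.congr_fun h c
  refine Finsupp.lhom_ext' fun t => LinearMap.ext_ring ?_
  simp only [LinearMap.comp_apply, Finsupp.lsingle_apply, LinearMap.smul_apply, LinearMap.id_apply,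
    reducedBoundary, nullHomotopy]
  rw [Finsupp.linearCombination_single, one_smul, map_smul, map_sum,
    sum_congr rfl fun z _ => augmentation_consChain z t, sum_const, card_univ, ← natCast_zsmul,
    smul_smul, mul_comm]

theorem reducedBoundary_nullHomotopy_succ {m : ℕ} (hX : IsAlmostQuasigroup X m)
    (hS : ∀ a : X, IsTrivialSubquandle (stabilizerSet a)) (n : ℕ) (c : RackChain X (n + 1)) :
    reducedBoundary X (n + 1) (nullHomotopy X m (n + 1) c) +
      nullHomotopy X m n (reducedBoundary X n c) -
      ((Fintype.card X : ℤ) * ((Fintype.card X : ℤ) - m)) • c ∈ degenerate X (n + 1) := by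
  match n with
  | 0 =>
    suffices h : reducedBoundary X 1 ∘ₗ nullHomotopy X m 1 +
        nullHomotopy X m 0 ∘ₗ reducedBoundary X 0 =
        ((Fintype.card X : ℤ) * ((Fintype.card X : ℤ) - m)) • LinearMap.id by
      have h' := LinearMap.congr_fun h c
      simp only [LinearMap.add_apply, LinearMap.comp_apply, LinearMap.smul_apply,
        LinearMap.id_apply] at h'
      rw [h', sub_self]
      exact Submodule.zero_mem _
    refine rackChain_hom_ext fun a t => ?_
    simp only [LinearMap.add_apply, LinearMap.comp_apply, LinearMap.smul_apply, LinearMap.id_apply,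
      reducedBoundary, nullHomotopy]
    rw [rackBoundary_insertSecond_zero hX hS, augmentation_consChain,
      Finsupp.linearCombination_single]
    module
  | n + 1 =>
    have hrep := repeatSecond_mem_degenerate
      (((Fintype.card X : ℤ) * ((Fintype.card X : ℤ) - m)) • c)
    -- The degree 1 homotopy has no `repeatSecond` correction, but none is needed there, since the
    -- boundary of (b, b) is zero.
    have hcomm : nullHomotopy X m (n + 1) ∘ₗ rackBoundary X (n + 1) =
        insertSecond X n ∘ₗ rackBoundary X (n + 1) ∘ₗ (LinearMap.id - repeatSecond X n) := by
      rw [LinearMap.comp_sub, LinearMap.comp_id]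
      match n with
      | 0 => rw [rackBoundary_repeatSecond_zero, sub_zero]; rfl
      | n + 1 => rw [rackBoundary_repeatSecond]; rfl
    suffices h : rackBoundary X (n + 2) ∘ₗ nullHomotopy X m (n + 2) +
        nullHomotopy X m (n + 1) ∘ₗ rackBoundary X (n + 1) =
        ((Fintype.card X : ℤ) * ((Fintype.card X : ℤ) - m)) •
          (LinearMap.id - repeatSecond X n) by
      have h' := LinearMap.congr_fun h c
      simp only [LinearMap.add_apply, LinearMap.comp_apply, LinearMap.smul_apply,
        LinearMap.id_apply, LinearMap.sub_apply] at h'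
      change rackBoundary X (n + 2) _ + nullHomotopy X m (n + 1) (rackBoundary X (n + 1) c) - _ ∈ _
      rw [h', smul_sub, sub_sub_cancel_left, ← map_smul]
      exact Submodule.neg_mem _ hrep
    rw [hcomm]
    refine rackChain_hom_ext fun a t => ?_
    simp only [LinearMap.add_apply, LinearMap.comp_apply, LinearMap.smul_apply, LinearMap.id_apply,
      LinearMap.sub_apply, nullHomotopy]
    have h1 := rackBoundary_insertSecond hX hS a t
    have h2 := rackBoundary_insertSecond hX hS (t 0) t
    rw [repeatSecond_consChain, map_sub, map_sub, map_sub, map_sub, sub_add_sub_comm, h1, h2]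
    module

/-- Cycles become boundaries after multiplication by `|X| (|X| - m)`. -/
theorem exists_boundary_eq_smul {m : ℕ} (hX : IsAlmostQuasigroup X m)
    (hS : ∀ a : X, IsTrivialSubquandle (stabilizerSet a)) (n : ℕ) (c : QuandleChain X n)
    (hc : ∀ k (h : n = k + 1), reducedQuandleBoundary X k (h ▸ c) = 0) :
    ∃ b : QuandleChain X (n + 1), reducedQuandleBoundary X n b =
      ((Fintype.card X : ℤ) * ((Fintype.card X : ℤ) - m)) • c := by
  obtain ⟨c, rfl⟩ := Submodule.Quotient.mk_surjective _ c
  refine ⟨Submodule.Quotient.mk (nullHomotopy X m n c), ?_⟩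
  change Submodule.Quotient.mk (reducedBoundary X n (nullHomotopy X m n c)) = _
  match n with
  | 0 => rw [reducedBoundary_nullHomotopy_zero, Submodule.Quotient.mk_smul]
  | n + 1 =>
    have hc' : Submodule.Quotient.mk (reducedBoundary X n c) = (0 : QuandleChain X n) :=
      hc n rfl
    rw [Submodule.Quotient.mk_eq_zero] at hc'
    rw [← Submodule.Quotient.mk_smul, Submodule.Quotient.eq]
    -- A quandle cycle lifts only to a rack chain with degenerate boundary; the homotopy keeps that
    -- boundary degenerate.
    have h := Submodule.sub_mem _ (reducedBoundary_nullHomotopy_succ hX hS n c)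
      (nullHomotopy_degenerate m n hc')
    convert h using 1
    abel

end Homotopy

/-! ### Passage to homology and divisibility -/

section Homology

open CategoryTheory

variable {X : Type v} [Quandle X] [Fintype X]

theorem smul_reducedQuandleHomology {m : ℕ} (hX : IsAlmostQuasigroup X m)
    (hS : ∀ a : X, IsTrivialSubquandle (stabilizerSet a)) (n : ℕ)
    (z : ReducedQuandleHomology X n) :
    ((Fintype.card X : ℤ) * ((Fintype.card X : ℤ) - m)) • z = 0 := by
  set C := reducedQuandleComplex X
  obtain ⟨w, rfl⟩ := (ModuleCat.epi_iff_surjective (C.homologyπ n)).1 inferInstance z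
  obtain ⟨b, hb⟩ := exists_boundary_eq_smul hX hS n (C.iCycles n w) (by
    rintro k rfl
    have h : (C.iCycles (k + 1) ≫ C.d (k + 1) k) w = 0 := by
      rw [HomologicalComplex.iCycles_d]; rfl
    rw [reducedQuandleComplex_d] at h
    exact h)
  -- Equality of cycles can be tested on the underlying chains.
  have hw : ((Fintype.card X : ℤ) * ((Fintype.card X : ℤ) - m)) • w = C.toCycles (n + 1) n b := by
    apply (ModuleCat.mono_iff_injective (C.iCycles n)).1 inferInstance
    have h : (C.toCycles (n + 1) n ≫ C.iCycles n) b = reducedQuandleBoundary X n b := by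
      rw [HomologicalComplex.toCycles_i, reducedQuandleComplex_d]
      rfl
    rw [map_zsmul]
    exact hb.symm.trans h.symm
  rw [← map_zsmul, hw]
  have h : (C.toCycles (n + 1) n ≫ C.homologyπ n) b = 0 := by
    rw [HomologicalComplex.toCycles_comp_homologyπ]; rfl
  exact h

end Homology

/-- The product is gcd times lcm, and the gcd divides the difference k - (k - m) = m. -/
theorem mul_sub_dvd_mul_lcm {k m : ℕ} (h : m ≤ k) : k * (k - m) ∣ m * Nat.lcm k (k - m) := by
  rw [← Nat.gcd_mul_lcm k (k - m)]
  refine Nat.mul_dvd_mul_right ?_ _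
  have h1 := Nat.dvd_sub (Nat.gcd_dvd_left k (k - m)) (Nat.gcd_dvd_right k (k - m))
  rwa [Nat.sub_sub_self h] at h1

end QuandleHomology

theorem corollary3p3 {X : Type*} [Quandle X] [Finite X] (m : ℕ)
    (hX : QuandleHomology.IsAlmostQuasigroup X m)
    (hS : ∀ a : X, QuandleHomology.IsTrivialSubquandle (QuandleHomology.stabilizerSet a))
    (hnt : ¬ QuandleHomology.IsTrivialQuandle X)
    (n : ℕ) (z : QuandleHomology.ReducedQuandleHomology X n) :
    (m * Nat.lcm (Nat.card X) (Nat.card X - m)) • z = 0 := by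
  have := Fintype.ofFinite X
  -- Nontriviality supplies an element, so m = |S_a| ≤ |X| and the truncated subtraction agrees with
  -- the integer one.
  obtain ⟨a, -⟩ := not_forall.1 hnt
  have hm : m ≤ Nat.card X := by
    rw [← QuandleHomology.card_stabilizerFinset hX a, Nat.card_eq_fintype_card]
    exact Finset.card_le_univ _
  obtain ⟨l, hl⟩ := QuandleHomology.mul_sub_dvd_mul_lcm hm
  have h := QuandleHomology.smul_reducedQuandleHomology hX hS n z
  rw [← Nat.card_eq_fintype_card, ← Nat.cast_sub hm, ← Nat.cast_mul, natCast_zsmul] at h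
  rw [hl, mul_comm, mul_smul, h, smul_zero]
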